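/- Consider the linearly restricted Gaussian vector autoregression $X_0=0$, $X_{t+1}=AX_t+\eta_t$ $(0\le t\le n)$ in $\mathbb R^d$, where $\eta_0,\dots,\eta_n$ are i.i.d. $N(0,\sigma^2I_d)$ with $\sigma>0$, and $\beta=\mathrm{vec}(A^{\mathrm T})\in\mathcal L=\{R\theta+\gamma:\theta\in\mathbb R^m\}$ for a known $d^2\times m$ matrix $R$ of rank $m$ and a known $\gamma\in\mathbb R^{d^2}$. Let $A(\theta)$ be the matrix with $\mathrm{vec}\{A(\theta)^{\mathrm T}\}=R\theta+\gamma$, let $\mathrm{pr}^{(n)}_\theta$ be the law of $(X_1,\dots,X_{n+1})$ when $A=A(\theta)$, let $\rho\{A\}$ denote the spectral radius, and for $\bar\rho>0$ put $\Theta(\bar\rho)=\{\theta:\rho\{A(\theta)\}\le\bar\rho\}$. Let $D=\min_{\beta\in\mathcal L}\|\beta\|$ (so $D=0$ for homogeneous restrictions, $\gamma=0$). There is a universal constant $C>0$, and for every fixed $c>0$ a constant $C_c>0$ depending only on $c$, such that for all $n\ge1$, $d$, $m$, $R$, $\gamma$, $\sigma>0$, $\delta\in(0,1/4)$ and $\bar\rho>0$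 with $D<\bar\rho$, $$\inf_{\widehat\beta}\ \sup_{\theta\in\Theta(\bar\rho)}\mathrm{pr}^{(n)}_\theta\Bigl\{\|\widehat\beta-(R\theta+\gamma)\|\ \ge\ \min\Bigl(r_n,\ \tfrac{\bar\rho-D}{4}\Bigr)\Bigr\}\ \ge\ \delta,$$ where the infimum is over all measurable functions $\widehat\beta$ of $(X_1,\dots,X_{n+1})$ with values in $\mathcal L$, and (i) $r_n=C\{(1-\bar\rho^2)m/n\}^{1/2}$ if $0<\bar\rho<(1-1/n)^{1/2}$; (ii) $r_n=C_c\,m^{1/2}/n$ if $(1-1/n)^{1/2}\le\bar\rho\le1+c/n$; (iii) $r_n=C\,\bar\rho^{-n}\{(\bar\rho^2-1)m/n\}^{1/2}$ if $\bar\rho>1+c/n$. In particular, for $\gamma=0$ the minimax lower bound on the estimation error over $\mathcal L(\bar\rho)=\{R\theta+\gamma:\theta\in\Theta(\bar\rho)\}$ is of order $r_n$ whenever $r_n\le\bar\rho/4$. -/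

import Mathlib

open MeasureTheory ProbabilityTheory
open scoped ENNReal Matrix

namespace RestrictedVAR

/-- State space `ℝ^d` with the Euclidean norm. -/
abbrev State (d : ℕ) : Type := EuclideanSpace ℝ (Fin d)

/-- The space `ℝ^N`, `N = d²`, of vectors `β = vec(Aᵀ)`; the entry with index `(i, j)` is `A i j`.
Its Euclidean norm is the Frobenius norm of `A`. -/
abbrev Coef (d : ℕ) : Type := EuclideanSpace ℝ (Fin d × Fin d)

/-- The transition matrix `A` with `vec(Aᵀ) = β`. -/
def transition {d : ℕ} (β : Coef d) : Matrix (Fin d) (Fin d) ℝ :=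
  Matrix.of fun i j => β (i, j)

/-- `β = R θ + γ`. -/
noncomputable def coef {d m : ℕ} (R : Matrix (Fin d × Fin d) (Fin m) ℝ) (γ : Coef d)
    (θ : EuclideanSpace ℝ (Fin m)) : Coef d :=
  WithLp.toLp 2 (R *ᵥ (θ : Fin m → ℝ)) + γ

/-- The restricted parameter space `L = {R θ + γ : θ ∈ ℝ^m}`. -/
def restricted {d m : ℕ} (R : Matrix (Fin d × Fin d) (Fin m) ℝ) (γ : Coef d) : Set (Coef d) :=
  Set.range (coef R γ)

/-- The spectral radius of a real matrix: the largest modulus of its complex eigenvalues. -/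
noncomputable def specRad {d : ℕ} (A : Matrix (Fin d) (Fin d) ℝ) : ℝ≥0∞ :=
  spectralRadius ℂ (A.map (algebraMap ℝ ℂ))

/-- `Θ(ρ) = {θ : the spectral radius of A(θ) is at most ρ}`. -/
def Theta {d m : ℕ} (R : Matrix (Fin d × Fin d) (Fin m) ℝ) (γ : Coef d) (ρ : ℝ) :
    Set (EuclideanSpace ℝ (Fin m)) :=
  {θ | specRad (transition (coef R γ θ)) ≤ ENNReal.ofReal ρ}

/-- The path driven by the innovations `η_0, …, η_n`: `X_0 = 0`, `X_{t+1} = A X_t + η_t` for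
`0 ≤ t ≤ n` (innovations after time `n` are irrelevant and set to zero). -/
noncomputable def path {d n : ℕ} (A : Matrix (Fin d) (Fin d) ℝ) (η : Fin (n + 1) → State d) :
    ℕ → State d
  | 0 => 0
  | t + 1 => WithLp.toLp 2 (A *ᵥ (path A η t : Fin d → ℝ)) +
      if h : t < n + 1 then η ⟨t, h⟩ else 0

/-- The joint law of the i.i.d. innovations `η_0, …, η_n ∼ N(0, σ² I_d)`. -/
noncomputable def innovationLaw (d n : ℕ) (σ : ℝ) : Measure (Fin (n + 1) → State d) :=
  Measure.pi fun _ => multivariateGaussian 0 (σ ^ 2 • (1 : Matrix (Fin d) (Fin d) ℝ))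

/-- The law of the sample `(X_1, …, X_{n+1})` when the transition matrix is `A`. -/
noncomputable def sampleLaw {d : ℕ} (n : ℕ) (σ : ℝ) (A : Matrix (Fin d) (Fin d) ℝ) :
    Measure (Fin (n + 1) → State d) :=
  (innovationLaw d n σ).map fun η t => path A η (t + 1)

/-- Estimators of `β`: measurable functions of the sample with values in the restricted space. -/
def Estimator {d m : ℕ} (n : ℕ) (R : Matrix (Fin d × Fin d) (Fin m) ℝ) (γ : Coef d) : Type :=
  {b : (Fin (n + 1) → State d) → Coef d // Measurable b ∧ ∀ x, b x ∈ restricted R γ}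

/-- `inf_b sup_{θ ∈ Θ(ρ)} pr_θ^{(n)} {‖b - β(θ)‖ ≥ ε}`, the infimum being over all estimators. -/
noncomputable def minimaxProb {d m : ℕ} (n : ℕ) (σ : ℝ) (R : Matrix (Fin d × Fin d) (Fin m) ℝ)
    (γ : Coef d) (ρ ε : ℝ) : ℝ≥0∞ :=
  ⨅ b : Estimator n R γ, ⨆ θ ∈ Theta R γ ρ,
    sampleLaw n σ (transition (coef R γ θ)) {x | ε ≤ ‖b.1 x - coef R γ θ‖}

/-- The distance of the restricted space `L` from the origin, i.e. the smallest Frobenius norm of an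
admissible transition matrix; it vanishes for homogeneous restrictions (`γ = 0`). -/
noncomputable def offset {d m : ℕ} (R : Matrix (Fin d × Fin d) (Fin m) ℝ) (γ : Coef d) : ℝ :=
  Metric.infDist 0 (restricted R γ)

end RestrictedVAR

/-! The proof compares two points only, the second found by averaging, so no packing or Fano
inequality is needed. Pick `β₀` in the restricted space with norm below `(D + ρ) / 2`. For any
estimator and `0 < ε ≤ (ρ - D) / 4`, consider the `β₀ + v` with `v` in the range of `R` and `‖v‖ <
2ε`. By Fubini and the ratio of ball volumes, the law at `β₀` gives some event "the estimate is
within `ε` of `β₀ + v`" probability at most `2^(-m)` (`exists_measure_norm_sub_lt_le`).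

That event is carried over to the law at `β₀ + v` by a change of measure (`sampleLaw_add_le`)
costing a factor `exp (m / 10)`, outbalanced by `2^(-m)`, plus two errors: the chance that the
signal energy is large, and a Chernoff bound for the log likelihood ratio. The Chernoff tilt is
again a likelihood of the autoregression, at `A + (1 + u) B`, so its total mass is one. The energy
has mean at most `‖v‖² * covSum n ρ` (`sampleLaw_energy_ge_le`), hence Markov's inequality applies
as soon as `ε² * covSum n ρ ≤ m / 40000`. Altogether the event has probability at most `3/4` at `β₀
+ v`.

The Frobenius norm dominates the spectral radius (`specRad_le`), so `‖β₀ + v‖ ≤ ρ` keeps the second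
point in `Theta R γ ρ`. The three rates come from three bounds on the geometric sums in `covSum`. -/

namespace RestrictedVAR

/-! ### Densities of product measures and of images -/

section Density

variable {ι : Type*} [Fintype ι] {E : ι → Type*} [∀ i, MeasurableSpace (E i)]

/-- A product of measures with integrable densities has the product density. -/
lemma pi_withDensity_ofReal (μ : ∀ i, Measure (E i)) [∀ i, SigmaFinite (μ i)]
    (f : ∀ i, E i → ℝ) (hf : ∀ i, Integrable (f i) (μ i)) (hf0 : ∀ i x, 0 ≤ f i x) :
    Measure.pi (fun i => (μ i).withDensity fun x => ENNReal.ofReal (f i x)) =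
      (Measure.pi μ).withDensity fun x => ENNReal.ofReal (∏ i, f i (x i)) := by
  have : ∀ i, IsFiniteMeasure ((μ i).withDensity fun x => ENNReal.ofReal (f i x)) := fun i =>
    isFiniteMeasure_withDensity_ofReal (hf i).2
  refine Measure.pi_eq fun s hs => ?_
  rw [withDensity_apply _ (MeasurableSet.univ_pi hs), Measure.restrict_pi_pi,
    ← ofReal_integral_eq_lintegral_ofReal
      (Integrable.fintype_prod_dep fun i => (hf i).mono_measure Measure.restrict_le_self)
      (ae_of_all _ fun x => Finset.prod_nonneg fun i _ => hf0 i (x i)),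
    integral_fintype_prod_eq_prod, ENNReal.ofReal_prod_of_nonneg]
  · refine Finset.prod_congr rfl fun i _ => ?_
    rw [withDensity_apply _ (hs i), ofReal_integral_eq_lintegral_ofReal
      ((hf i).mono_measure Measure.restrict_le_self) (ae_of_all _ (hf0 i))]
  · exact fun i _ => integral_nonneg (hf0 i)

/-- The image of a measure with a density, under a right inverse of a measure preserving map. -/
lemma map_withDensity_of_leftInverse {X : Type*} [MeasurableSpace X] {μ : Measure X}
    {r p : X → X} (hr : MeasurePreserving r μ μ) (hp : Measurable p)
    (hpr : Function.LeftInverse p r) {f : X → ℝ≥0∞} (hf : Measurable f) :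
    (μ.withDensity f).map p = μ.withDensity (f ∘ r) := by
  ext s hs
  rw [Measure.map_apply hp hs, withDensity_apply _ (hp hs), withDensity_apply _ hs,
    ← lintegral_indicator (hp hs), ← lintegral_indicator hs,
    ← hr.lintegral_comp (hf.indicator (hp hs))]
  refine lintegral_congr fun x => ?_
  by_cases hx : x ∈ s <;> simp [Set.indicator, hpr x, hx]

end Density

/-! ### Gaussian innovations: density, symmetry, second moments -/

/-- The density of `N(0, σ² I_d)`. -/
noncomputable def gaussDensity (d : ℕ) (σ : ℝ) (x : State d) : ℝ :=
  (√(2 * Real.pi * σ ^ 2))⁻¹ ^ d * Real.exp (-‖x‖ ^ 2 / (2 * σ ^ 2))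

lemma gaussDensity_pos {d : ℕ} {σ : ℝ} (hσ : 0 < σ) (x : State d) : 0 < gaussDensity d σ x := by
  have := Real.pi_pos
  unfold gaussDensity
  positivity

lemma measurable_gaussDensity (d : ℕ) (σ : ℝ) : Measurable (gaussDensity d σ) := by
  unfold gaussDensity
  fun_prop

lemma prod_gaussianPDFReal (d : ℕ) (σ : ℝ) (x : Fin d → ℝ) :
    ∏ i, gaussianPDFReal 0 (Real.toNNReal (σ ^ 2)) (x i) =
      gaussDensity d σ (WithLp.toLp 2 x) := by
  unfold gaussDensity gaussianPDFReal
  rw [Finset.prod_mul_distrib, ← Real.exp_sum, EuclideanSpace.real_norm_sq_eq]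
  simp [Real.coe_toNNReal _ (sq_nonneg σ), Finset.sum_div, neg_div]

lemma posSemidef_sq_smul_one (d : ℕ) (σ : ℝ) :
    (σ ^ 2 • (1 : Matrix (Fin d) (Fin d) ℝ)).PosSemidef :=
  Matrix.PosSemidef.one.smul (sq_nonneg σ)

lemma multivariateGaussian_eq_map_pi (d : ℕ) (σ : ℝ) :
    multivariateGaussian 0 (σ ^ 2 • (1 : Matrix (Fin d) (Fin d) ℝ)) =
      (Measure.pi fun _ => gaussianReal 0 (Real.toNNReal (σ ^ 2))).map (WithLp.toLp 2) := by
  apply Measure.ext_of_charFun (E := EuclideanSpace ℝ (Fin d))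
  ext t
  rw [charFun_pi, charFun_multivariateGaussian (posSemidef_sq_smul_one d σ)]
  simp_rw [charFun_gaussianReal, ← Complex.exp_sum]
  simp [Matrix.smul_mulVec, dotProduct, Finset.sum_div]
  rw [max_eq_left (sq_nonneg σ)]
  congr 2
  refine Finset.sum_congr rfl fun i _ => ?_
  push_cast
  ring

lemma integrable_gaussDensity {d : ℕ} {σ : ℝ} : Integrable (gaussDensity d σ) := by
  rw [← (PiLp.volume_preserving_toLp (Fin d)).integrable_comp_emb
    (MeasurableEquiv.toLp 2 (Fin d → ℝ)).measurableEmbedding]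
  simp only [Function.comp_def, ← prod_gaussianPDFReal]
  exact Integrable.fintype_prod fun _ => integrable_gaussianPDFReal _ _

lemma multivariateGaussian_eq_withDensity (d : ℕ) {σ : ℝ} (hσ : 0 < σ) :
    multivariateGaussian 0 (σ ^ 2 • (1 : Matrix (Fin d) (Fin d) ℝ)) =
      volume.withDensity fun x => ENNReal.ofReal (gaussDensity d σ x) := by
  have hv : Real.toNNReal (σ ^ 2) ≠ 0 := by
    rw [ne_eq, Real.toNNReal_eq_zero, not_le]
    positivity
  rw [multivariateGaussian_eq_map_pi, gaussianReal_of_var_ne_zero _ hv, gaussianPDF_def,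
    pi_withDensity_ofReal _ _ (fun _ => integrable_gaussianPDFReal _ _)
      (fun _ => gaussianPDFReal_nonneg _ _), ← volume_pi]
  ext s hs
  have hm : Measurable (WithLp.toLp 2 : (Fin d → ℝ) → State d) := by fun_prop
  rw [Measure.map_apply hm hs, withDensity_apply _ (hm hs), withDensity_apply _ hs]
  simp_rw [prod_gaussianPDFReal]
  exact (PiLp.volume_preserving_toLp (Fin d)).setLIntegral_comp_preimage hs
    (measurable_gaussDensity d σ).ennreal_ofReal

lemma innovationLaw_eq_withDensity (d n : ℕ) {σ : ℝ} (hσ : 0 < σ) :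
    innovationLaw d n σ =
      volume.withDensity fun η => ENNReal.ofReal (∏ t, gaussDensity d σ (η t)) := by
  unfold innovationLaw
  rw [multivariateGaussian_eq_withDensity d hσ,
    pi_withDensity_ofReal _ _ (fun _ => integrable_gaussDensity)
      (fun _ x => (gaussDensity_pos hσ x).le), ← volume_pi]

instance isProbabilityMeasure_innovationLaw (d n : ℕ) (σ : ℝ) :
    IsProbabilityMeasure (innovationLaw d n σ) := by
  unfold innovationLaw
  infer_instance

lemma measurePreserving_neg_multivariateGaussian (d : ℕ) (σ : ℝ) :
    MeasurePreserving (fun x : State d => -x)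
      (multivariateGaussian 0 (σ ^ 2 • (1 : Matrix (Fin d) (Fin d) ℝ)))
      (multivariateGaussian 0 (σ ^ 2 • (1 : Matrix (Fin d) (Fin d) ℝ))) := by
  refine ⟨measurable_neg, ?_⟩
  apply Measure.ext_of_charFun (E := EuclideanSpace ℝ (Fin d))
  ext t
  have h := charFun_map_smul (μ := multivariateGaussian 0 (σ ^ 2 • (1 : Matrix (Fin d) (Fin d) ℝ)))
    (-1) t
  simp only [neg_smul, one_smul] at h
  rw [h]
  simp [charFun_multivariateGaussian (posSemidef_sq_smul_one d σ), Matrix.mulVec_neg]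

lemma lintegral_inner_sq_multivariateGaussian {d : ℕ} (σ : ℝ) (b : State d) :
    ∫⁻ x, ENNReal.ofReal (inner ℝ b x ^ 2)
      ∂(multivariateGaussian 0 (σ ^ 2 • (1 : Matrix (Fin d) (Fin d) ℝ))) =
      ENNReal.ofReal (σ ^ 2 * ‖b‖ ^ 2) := by
  set μ := multivariateGaussian 0 (σ ^ 2 • (1 : Matrix (Fin d) (Fin d) ℝ))
  have hL : MemLp (fun x : State d => inner ℝ b x) 2 μ :=
    (IsGaussian.memLp_two_id (μ := μ)).const_inner b
  have h0 : ∫ x, inner ℝ b x ∂μ = 0 := by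
    rw [integral_inner IsGaussian.integrable_fun_id]
    simp [μ]
  rw [← ofReal_integral_eq_lintegral_ofReal hL.integrable_sq (ae_of_all _ fun x => sq_nonneg _)]
  congr 1
  have h := covarianceBilin_multivariateGaussian (μ := 0) (posSemidef_sq_smul_one d σ) b b
  rw [covarianceBilin_self IsGaussian.memLp_two_id, variance_eq_integral (by fun_prop)] at h
  simp only [h0, sub_zero, μ] at h ⊢
  rw [h, EuclideanSpace.real_norm_sq_eq]
  simp [Matrix.smul_mulVec, dotProduct, Finset.mul_sum]
  exact Finset.sum_congr rfl fun i _ => by ring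

/-! ### Residual map and likelihood of the sample -/

/-- The linear operator `x ↦ A x` on the state space. -/
noncomputable abbrev act {d : ℕ} (A : Matrix (Fin d) (Fin d) ℝ) : State d →L[ℝ] State d :=
  Matrix.toEuclideanCLM (𝕜 := ℝ) A

/-- The sample shifted by one time step, started at zero. -/
def lag {d n : ℕ} (x : Fin (n + 1) → State d) (t : Fin (n + 1)) : State d :=
  Fin.cases 0 (fun s : Fin n => x s.castSucc) t

@[simp] lemma lag_zero {d n : ℕ} (x : Fin (n + 1) → State d) : lag x 0 = 0 := rfl

@[simp] lemma lag_succ {d n : ℕ} (x : Fin (n + 1) → State d) (s : Fin n) :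
    lag x s.succ = x s.castSucc := rfl

/-- The operator `(x_t) ↦ (A x_{t-1})` on samples. -/
noncomputable def lagAct {d : ℕ} (n : ℕ) (A : Matrix (Fin d) (Fin d) ℝ) :
    (Fin (n + 1) → State d) →ₗ[ℝ] (Fin (n + 1) → State d) where
  toFun x t := act A (lag x t)
  map_add' x y := by
    funext t
    refine Fin.cases ?_ (fun s => ?_) t <;> simp
  map_smul' c x := by
    funext t
    refine Fin.cases ?_ (fun s => ?_) t <;> simp

lemma lagAct_apply {d n : ℕ} (A : Matrix (Fin d) (Fin d) ℝ) (x : Fin (n + 1) → State d)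
    (t : Fin (n + 1)) : lagAct n A x t = act A (lag x t) := rfl

/-- Each application shifts by one time step and inserts a zero at the start. -/
lemma lagAct_pow_apply_eq_zero {d n : ℕ} (A : Matrix (Fin d) (Fin d) ℝ)
    (x : Fin (n + 1) → State d) (k : ℕ) (t : Fin (n + 1)) (ht : (t : ℕ) < k) :
    (lagAct n A ^ k) x t = 0 := by
  induction k generalizing t with
  | zero => simp at ht
  | succ k ih =>
    rw [pow_succ', Module.End.mul_apply, lagAct_apply]
    induction t using Fin.cases with
    | zero => simp
    | succ s =>
      rw [lag_succ, ih _ (by simp at ht ⊢; omega), map_zero]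

lemma isNilpotent_lagAct {d : ℕ} (n : ℕ) (A : Matrix (Fin d) (Fin d) ℝ) :
    IsNilpotent (lagAct n A) :=
  ⟨n + 1, LinearMap.ext fun x => funext fun t => lagAct_pow_apply_eq_zero A x _ t t.2⟩

/-- The residuals `x_t - A x_{t-1}` of a sample. -/
noncomputable def resid {d : ℕ} (n : ℕ) (A : Matrix (Fin d) (Fin d) ℝ) :
    (Fin (n + 1) → State d) →ₗ[ℝ] (Fin (n + 1) → State d) :=
  1 - lagAct n A

lemma resid_apply {d n : ℕ} (A : Matrix (Fin d) (Fin d) ℝ) (x : Fin (n + 1) → State d)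
    (t : Fin (n + 1)) : resid n A x t = x t - act A (lag x t) := rfl

/-- A nilpotent map has characteristic polynomial `X ^ N`, and its value at `1` is this determinant.
Hence passing from samples to residuals preserves Lebesgue measure, and the likelihood has no
Jacobian factor. -/
lemma det_resid {d : ℕ} (n : ℕ) (A : Matrix (Fin d) (Fin d) ℝ) :
    LinearMap.det (resid n A) = 1 := by
  have h := LinearMap.eval_charpoly (lagAct n A) 1
  rw [(isNilpotent_lagAct n A).charpoly_eq_X_pow_finrank] at h
  simpa [resid] using h.symm

lemma measurePreserving_resid {d : ℕ} (n : ℕ) (A : Matrix (Fin d) (Fin d) ℝ) :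
    MeasurePreserving (resid n A) := by
  refine ⟨(LinearMap.continuous_of_finiteDimensional _).measurable, ?_⟩
  rw [Measure.map_linearMap_addHaar_eq_smul_addHaar _ (by simp [det_resid])]
  simp [det_resid]

lemma path_succ {d n : ℕ} (A : Matrix (Fin d) (Fin d) ℝ) (η : Fin (n + 1) → State d)
    (t : Fin (n + 1)) : path A η (t + 1) = act A (path A η t) + η t := by
  simp only [path, t.2, dif_pos]
  rfl

lemma lag_path {d n : ℕ} (A : Matrix (Fin d) (Fin d) ℝ) (η : Fin (n + 1) → State d)
    (t : Fin (n + 1)) : lag (fun s => path A η (s + 1)) t = path A η t := by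
  induction t using Fin.cases with
  | zero => rfl
  | succ s => simp

lemma resid_path {d n : ℕ} (A : Matrix (Fin d) (Fin d) ℝ) (η : Fin (n + 1) → State d) :
    resid n A (fun t => path A η (t + 1)) = η := by
  funext t
  rw [resid_apply, lag_path, path_succ, add_sub_cancel_left]

lemma path_resid {d n : ℕ} (A : Matrix (Fin d) (Fin d) ℝ) (x : Fin (n + 1) → State d) :
    (fun t : Fin (n + 1) => path A (resid n A x) (t + 1)) = x := by
  have hinj : Function.Injective (resid n A) := by
    have : IsUnit (LinearMap.det (resid n A)) := by simp [det_resid]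
    exact (LinearMap.isUnit_iff_ker_eq_bot _).1 ((LinearMap.isUnit_iff_isUnit_det _).2 this)
      |> LinearMap.ker_eq_bot.1
  -- `resid_path` gives one inverse identity; injectivity upgrades it to the other.
  exact hinj (resid_path A _)

lemma measurable_path {d n : ℕ} (A : Matrix (Fin d) (Fin d) ℝ) (t : ℕ) :
    Measurable fun η : Fin (n + 1) → State d => path A η t := by
  induction t with
  | zero => exact measurable_const
  | succ t ih =>
    by_cases h : t < n + 1
    · have : (fun η : Fin (n + 1) → State d => path A η (t + 1)) =
          fun η => act A (path A η t) + η ⟨t, h⟩ := funext fun η => path_succ A η ⟨t, h⟩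
      rw [this]
      exact ((act A).continuous.measurable.comp ih).add (measurable_pi_apply _)
    · have : (fun η : Fin (n + 1) → State d => path A η (t + 1)) =
          fun η => act A (path A η t) := funext fun η => by simp [path, h]; rfl
      rw [this]
      exact (act A).continuous.measurable.comp ih

lemma measurable_sample {d n : ℕ} (A : Matrix (Fin d) (Fin d) ℝ) :
    Measurable fun (η : Fin (n + 1) → State d) (t : Fin (n + 1)) => path A η (t + 1) :=
  measurable_pi_lambda _ fun t => measurable_path A (t + 1)

instance isProbabilityMeasure_sampleLaw {d : ℕ} (n : ℕ) (σ : ℝ) (A : Matrix (Fin d) (Fin d) ℝ) :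
    IsProbabilityMeasure (sampleLaw n σ A) :=
  Measure.isProbabilityMeasure_map (measurable_sample A).aemeasurable

/-- The likelihood of the transition matrix `A`. -/
noncomputable def likelihood {d : ℕ} (n : ℕ) (σ : ℝ) (A : Matrix (Fin d) (Fin d) ℝ)
    (x : Fin (n + 1) → State d) : ℝ :=
  ∏ t, gaussDensity d σ (resid n A x t)

lemma measurable_likelihood {d : ℕ} (n : ℕ) (σ : ℝ) (A : Matrix (Fin d) (Fin d) ℝ) :
    Measurable (likelihood n σ A) := by
  refine Finset.measurable_prod _ fun t _ => (measurable_gaussDensity d σ).comp ?_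
  exact (measurable_pi_apply t).comp (measurePreserving_resid n A).measurable

lemma sampleLaw_eq_withDensity {d : ℕ} (n : ℕ) {σ : ℝ} (hσ : 0 < σ)
    (A : Matrix (Fin d) (Fin d) ℝ) :
    sampleLaw n σ A = volume.withDensity fun x => ENNReal.ofReal (likelihood n σ A x) := by
  have hm : Measurable fun η : Fin (n + 1) → State d => ∏ t, gaussDensity d σ (η t) :=
    Finset.measurable_prod _ fun t _ => (measurable_gaussDensity d σ).comp (measurable_pi_apply t)
  unfold sampleLaw
  rw [innovationLaw_eq_withDensity d n hσ]
  exact map_withDensity_of_leftInverse (measurePreserving_resid n A) (measurable_sample A)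
    (path_resid A) hm.ennreal_ofReal

lemma likelihood_eq {d n : ℕ} (σ : ℝ) (A : Matrix (Fin d) (Fin d) ℝ)
    (x : Fin (n + 1) → State d) :
    likelihood n σ A x = ((√(2 * Real.pi * σ ^ 2))⁻¹ ^ d) ^ (n + 1) *
      Real.exp (-(∑ t, ‖resid n A x t‖ ^ 2) / (2 * σ ^ 2)) := by
  simp [likelihood, gaussDensity, Finset.prod_mul_distrib, ← Real.exp_sum, Finset.sum_div, neg_div]

/-! ### Likelihood ratios and change of measure -/

/-- The normalized energy `σ⁻² ∑ ‖B x_{t-1}‖²` of the signal `B x_{t-1}`. -/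
noncomputable def energy {d : ℕ} (n : ℕ) (σ : ℝ) (B : Matrix (Fin d) (Fin d) ℝ)
    (x : Fin (n + 1) → State d) : ℝ :=
  (∑ t, ‖act B (lag x t)‖ ^ 2) / σ ^ 2

lemma likelihood_add {d n : ℕ} {σ : ℝ} (hσ : 0 < σ) (A B : Matrix (Fin d) (Fin d) ℝ)
    (u : ℝ) (x : Fin (n + 1) → State d) :
    likelihood n σ (A + u • B) x = likelihood n σ A x *
      Real.exp (u * ((∑ t, inner ℝ (resid n A x t) (act B (lag x t))) / σ ^ 2) -
        u ^ 2 * energy n σ B x / 2) := by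
  have h : ∀ t, ‖resid n (A + u • B) x t‖ ^ 2 = ‖resid n A x t‖ ^ 2 -
      2 * u * inner ℝ (resid n A x t) (act B (lag x t)) + u ^ 2 * ‖act B (lag x t)‖ ^ 2 := by
    intro t
    have : resid n (A + u • B) x t = resid n A x t - u • act B (lag x t) := by
      simp only [resid_apply, act, map_add, map_smul, add_apply,
        smul_apply]
      abel
    rw [this, norm_sub_sq_real, real_inner_smul_right, norm_smul, mul_pow, Real.norm_eq_abs,
      sq_abs]
    ring
  rw [likelihood_eq, likelihood_eq, mul_assoc (_ ^ (n + 1)), ← Real.exp_add]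
  simp_rw [h]
  rw [Finset.sum_add_distrib, Finset.sum_sub_distrib, ← Finset.mul_sum, ← Finset.mul_sum]
  congr 2
  unfold energy
  field_simp
  ring

/-- Where the energy of `B` is small, the likelihood at `A + B` is dominated either by the
likelihood at `A` or by the one at `A + (1 + u) B`. -/
lemma likelihood_le_or_le {d n : ℕ} {σ : ℝ} (hσ : 0 < σ) (A B : Matrix (Fin d) (Fin d) ℝ)
    {u l v : ℝ} (hu : 0 ≤ u) (x : Fin (n + 1) → State d) (hx : energy n σ B x ≤ v) :
    likelihood n σ (A + B) x ≤ Real.exp l * likelihood n σ A x ∨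
      likelihood n σ (A + B) x ≤
        Real.exp (-(u * l - (u + u ^ 2) * v / 2)) * likelihood n σ (A + (1 + u) • B) x := by
  have h1 := likelihood_add hσ A B 1 x
  have h2 := likelihood_add hσ A B (1 + u) x
  rw [one_smul] at h1
  set F := (∑ t, inner ℝ (resid n A x t) (act B (lag x t))) / σ ^ 2
  set V := energy n σ B x
  have hL : 0 ≤ likelihood n σ A x := Finset.prod_nonneg fun t _ => (gaussDensity_pos hσ _).le
  -- `F - V / 2` is the log likelihood ratio of `A + B` to `A`.
  by_cases hF : F - V / 2 ≤ l
  · left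
    rw [h1, mul_comm]
    refine mul_le_mul_of_nonneg_right (Real.exp_le_exp.2 ?_) hL
    linarith
  -- The log likelihood ratio of `A + (1 + u) B` to `A + B` is `u (F - V / 2) - (u + u²) V / 2`,
  -- which is large when `F - V / 2 > l` and `V ≤ v`.
  · right
    rw [h1, h2, mul_left_comm, ← Real.exp_add]
    refine mul_le_mul_of_nonneg_left (Real.exp_le_exp.2 ?_) hL
    have h3 : u * l ≤ u * (F - V / 2) := mul_le_mul_of_nonneg_left (not_le.1 hF).le hu
    have h4 : (u + u ^ 2) * V ≤ (u + u ^ 2) * v := mul_le_mul_of_nonneg_left hx (by positivity)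
    nlinarith

lemma measurable_energy {d : ℕ} (n : ℕ) (σ : ℝ) (B : Matrix (Fin d) (Fin d) ℝ) :
    Measurable (energy n σ B) := by
  have h : ∀ t : Fin (n + 1), Measurable fun x : Fin (n + 1) → State d => act B (lag x t) :=
    fun t => (measurable_pi_apply t).comp
      (LinearMap.continuous_of_finiteDimensional (lagAct n B)).measurable
  unfold energy
  exact (Finset.measurable_sum _ fun t _ => (h t).norm.pow_const 2).div_const _

lemma sampleLaw_le_of_likelihood_le {d n : ℕ} {σ : ℝ} (hσ : 0 < σ)
    {A B : Matrix (Fin d) (Fin d) ℝ} {c : ℝ} (hc : 0 ≤ c) {s : Set (Fin (n + 1) → State d)}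
    (hs : MeasurableSet s)
    (h : ∀ x ∈ s, likelihood n σ A x ≤ c * likelihood n σ B x) :
    sampleLaw n σ A s ≤ ENNReal.ofReal c * sampleLaw n σ B s := by
  rw [sampleLaw_eq_withDensity n hσ, sampleLaw_eq_withDensity n hσ, withDensity_apply _ hs,
    withDensity_apply _ hs, ← lintegral_const_mul _ (measurable_likelihood n σ B).ennreal_ofReal]
  refine setLIntegral_mono_ae' hs (ae_of_all _ fun x hx => ?_)
  rw [← ENNReal.ofReal_mul hc]
  exact ENNReal.ofReal_le_ofReal (h x hx)

/-- Change of measure from the transition matrix `A + B` to `A`. -/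
lemma sampleLaw_add_le {d n : ℕ} {σ : ℝ} (hσ : 0 < σ) (A B : Matrix (Fin d) (Fin d) ℝ)
    {u : ℝ} (l v : ℝ) (hu : 0 ≤ u) {s : Set (Fin (n + 1) → State d)} (hs : MeasurableSet s) :
    sampleLaw n σ (A + B) s ≤ sampleLaw n σ (A + B) {x | v ≤ energy n σ B x} +
      ENNReal.ofReal (Real.exp l) * sampleLaw n σ A s +
      ENNReal.ofReal (Real.exp (-(u * l - (u + u ^ 2) * v / 2))) := by
  set s₁ := s ∩ {x | likelihood n σ (A + B) x ≤ Real.exp l * likelihood n σ A x}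
  set s₂ := s ∩ {x | likelihood n σ (A + B) x ≤
    Real.exp (-(u * l - (u + u ^ 2) * v / 2)) * likelihood n σ (A + (1 + u) • B) x}
  have hs₁ : MeasurableSet s₁ := hs.inter (measurableSet_le (measurable_likelihood n σ _)
    ((measurable_likelihood n σ _).const_mul _))
  have hs₂ : MeasurableSet s₂ := hs.inter (measurableSet_le (measurable_likelihood n σ _)
    ((measurable_likelihood n σ _).const_mul _))
  have hsub : s ⊆ ({x | v ≤ energy n σ B x} ∪ s₁) ∪ s₂ := by
    intro x hx
    by_cases hv : v ≤ energy n σ B x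
    · exact Or.inl (Or.inl hv)
    · rcases likelihood_le_or_le hσ A B (l := l) hu x (not_le.1 hv).le with h | h
      · exact Or.inl (Or.inr ⟨hx, h⟩)
      · exact Or.inr ⟨hx, h⟩
  calc sampleLaw n σ (A + B) s
      ≤ sampleLaw n σ (A + B) {x | v ≤ energy n σ B x} + sampleLaw n σ (A + B) s₁ +
        sampleLaw n σ (A + B) s₂ := (measure_mono hsub).trans <| (measure_union_le _ _).trans <|
          add_le_add_left (measure_union_le _ _) _
    _ ≤ _ := by
      refine add_le_add (add_le_add_right ?_ _) ?_
      · exact (sampleLaw_le_of_likelihood_le hσ (Real.exp_nonneg _) hs₁ fun x hx => hx.2).trans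
          (mul_le_mul_right (measure_mono Set.inter_subset_left) _)
      · exact (sampleLaw_le_of_likelihood_le hσ (Real.exp_nonneg _) hs₂ fun x hx => hx.2).trans
          (mul_le_of_le_one_right' prob_le_one)

/-! ### Frobenius norm and spectral radius -/

/-- The squared Frobenius norm. -/
def frobSq {d : ℕ} (A : Matrix (Fin d) (Fin d) ℝ) : ℝ := ∑ i, ∑ j, A i j ^ 2

lemma frobSq_nonneg {d : ℕ} (A : Matrix (Fin d) (Fin d) ℝ) : 0 ≤ frobSq A :=
  Finset.sum_nonneg fun _ _ => Finset.sum_nonneg fun _ _ => sq_nonneg _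

lemma frobSq_transition {d : ℕ} (β : Coef d) : frobSq (transition β) = ‖β‖ ^ 2 := by
  rw [EuclideanSpace.real_norm_sq_eq, Fintype.sum_prod_type]
  rfl

lemma frobSq_mul_le {d : ℕ} (A B : Matrix (Fin d) (Fin d) ℝ) :
    frobSq (A * B) ≤ frobSq A * frobSq B := by
  calc frobSq (A * B)
      ≤ ∑ i, ∑ j, (∑ k, A i k ^ 2) * ∑ k, B k j ^ 2 :=
        Finset.sum_le_sum fun i _ => Finset.sum_le_sum fun j _ => by
          rw [Matrix.mul_apply]
          exact Finset.sum_mul_sq_le_sq_mul_sq _ _ _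
    _ = frobSq A * frobSq B := by
      simp_rw [← Finset.mul_sum, ← Finset.sum_mul]
      rw [Finset.sum_comm (f := fun j k => B k j ^ 2)]
      rfl

lemma norm_act_sq {d : ℕ} (B : Matrix (Fin d) (Fin d) ℝ) (x : State d) :
    ‖act B x‖ ^ 2 = ∑ i, inner ℝ (WithLp.toLp 2 (B i) : State d) x ^ 2 := by
  rw [EuclideanSpace.real_norm_sq_eq]
  refine Finset.sum_congr rfl fun i _ => ?_
  simp [PiLp.inner_apply, Matrix.mulVec, dotProduct, mul_comm]

/-- For a complex eigenvector `w`, Cauchy–Schwarz in each row bounds `‖z w‖² = ‖A w‖²` by `‖A‖_F²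
‖w‖²`. -/
lemma specRad_le {d : ℕ} {A : Matrix (Fin d) (Fin d) ℝ} {ρ : ℝ} (hρ : 0 ≤ ρ)
    (hA : frobSq A ≤ ρ ^ 2) : specRad A ≤ ENNReal.ofReal ρ := by
  unfold specRad spectralRadius
  refine iSup₂_le fun z hz => ?_
  rw [← Matrix.spectrum_toLin', ← Module.End.hasEigenvalue_iff_mem_spectrum] at hz
  obtain ⟨w, hw⟩ := hz.exists_hasEigenvector
  have hw1 : (A.map (algebraMap ℝ ℂ)) *ᵥ w = z • w := by
    simpa using hw.apply_eq_smul
  have hw0 : 0 < ∑ j, ‖w j‖ ^ 2 := by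
    obtain ⟨j, hj⟩ := Function.ne_iff.1 hw.2
    refine Finset.sum_pos' (fun _ _ => sq_nonneg _) ⟨j, Finset.mem_univ _, ?_⟩
    have : 0 < ‖w j‖ := norm_pos_iff.2 hj
    positivity
  have h : ‖z‖ ^ 2 * ∑ j, ‖w j‖ ^ 2 ≤ ρ ^ 2 * ∑ j, ‖w j‖ ^ 2 := by
    calc ‖z‖ ^ 2 * ∑ j, ‖w j‖ ^ 2 = ∑ i, ‖((A.map (algebraMap ℝ ℂ)) *ᵥ w) i‖ ^ 2 := by
          rw [hw1]
          simp [mul_pow, Finset.mul_sum]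
      _ ≤ ∑ i, (∑ j, A i j ^ 2) * ∑ j, ‖w j‖ ^ 2 := Finset.sum_le_sum fun i _ => by
          have h1 : ‖((A.map (algebraMap ℝ ℂ)) *ᵥ w) i‖ ≤ ∑ j, |A i j| * ‖w j‖ := by
            rw [Matrix.mulVec, dotProduct]
            refine (norm_sum_le _ _).trans_eq (Finset.sum_congr rfl fun j _ => ?_)
            simp
          calc _ ≤ (∑ j, |A i j| * ‖w j‖) ^ 2 := pow_le_pow_left₀ (norm_nonneg _) h1 2
            _ ≤ (∑ j, |A i j| ^ 2) * ∑ j, ‖w j‖ ^ 2 := Finset.sum_mul_sq_le_sq_mul_sq _ _ _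
            _ = _ := by simp_rw [sq_abs]
      _ = frobSq A * ∑ j, ‖w j‖ ^ 2 := by rw [← Finset.sum_mul]; rfl
      _ ≤ _ := mul_le_mul_of_nonneg_right hA hw0.le
  have hz' : ‖z‖ ≤ ρ := le_of_sq_le_sq (le_of_mul_le_mul_right h hw0) hρ
  calc (‖z‖₊ : ℝ≥0∞) = ENNReal.ofReal ‖z‖ := (ofReal_norm z).symm
    _ ≤ _ := ENNReal.ofReal_le_ofReal hz'

lemma lintegral_norm_act_sq {d : ℕ} (σ : ℝ) (B : Matrix (Fin d) (Fin d) ℝ) :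
    ∫⁻ x, ENNReal.ofReal (‖act B x‖ ^ 2)
      ∂(multivariateGaussian 0 (σ ^ 2 • (1 : Matrix (Fin d) (Fin d) ℝ))) =
      ENNReal.ofReal (σ ^ 2 * frobSq B) := by
  simp_rw [norm_act_sq, ENNReal.ofReal_sum_of_nonneg fun i _ => sq_nonneg _]
  rw [lintegral_finsetSum _ fun i _ => by fun_prop]
  simp_rw [lintegral_inner_sq_multivariateGaussian]
  rw [← ENNReal.ofReal_sum_of_nonneg fun i _ => by positivity, ← Finset.mul_sum]
  simp [EuclideanSpace.real_norm_sq_eq, frobSq]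

/-! ### Second moments of the path and the energy bound -/

lemma path_congr {d n : ℕ} (A : Matrix (Fin d) (Fin d) ℝ) {η η' : Fin (n + 1) → State d} (t : ℕ)
    (h : ∀ s : Fin (n + 1), (s : ℕ) < t → η s = η' s) : path A η t = path A η' t := by
  induction t with
  | zero => rfl
  | succ t ih =>
    simp only [path]
    rw [ih fun s hs => h s (hs.trans t.lt_succ_self)]
    split_ifs with ht
    · rw [h ⟨t, ht⟩ t.lt_succ_self]
    · rfl

/-- Reflecting one innovation. -/
def reflect {d n : ℕ} (t : Fin (n + 1)) (η : Fin (n + 1) → State d) (s : Fin (n + 1)) : State d :=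
  (if s = t then fun x => -x else id) (η s)

lemma measurePreserving_reflect {d n : ℕ} (σ : ℝ) (t : Fin (n + 1)) :
    MeasurePreserving (reflect t) (innovationLaw d n σ) (innovationLaw d n σ) := by
  refine measurePreserving_pi _ _ fun s => ?_
  split_ifs
  · exact measurePreserving_neg_multivariateGaussian d σ
  · exact MeasurePreserving.id _

/-- Reflecting `η t` preserves the innovation law and leaves `path A η t` unchanged. Averaging over
the reflection and using the parallelogram law removes the cross term, with no integrability to
check. -/
lemma lintegral_norm_act_path_succ {d n : ℕ} (σ : ℝ) (A B : Matrix (Fin d) (Fin d) ℝ)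
    (t : Fin (n + 1)) :
    ∫⁻ η, ENNReal.ofReal (‖act B (path A η (t + 1))‖ ^ 2) ∂(innovationLaw d n σ) =
      ∫⁻ η, ENNReal.ofReal (‖act (B * A) (path A η t)‖ ^ 2) ∂(innovationLaw d n σ) +
        ENNReal.ofReal (σ ^ 2 * frobSq B) := by
  set μ := innovationLaw d n σ
  have hp := measurable_path (n := n) A t
  have hp' := measurable_path (n := n) A (t + 1)
  have hBA : act (B * A) = (act B).comp (act A) := map_mul _ B A
  have hm : Measurable fun η : Fin (n + 1) → State d =>
      ENNReal.ofReal (‖act B (path A η (t + 1))‖ ^ 2) := by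
    exact (((act B).continuous.measurable.comp hp').norm.pow_const 2).ennreal_ofReal
  have hm₁ : Measurable fun η : Fin (n + 1) → State d =>
      ENNReal.ofReal (‖act (B * A) (path A η t)‖ ^ 2) := by
    exact (((act _).continuous.measurable.comp hp).norm.pow_const 2).ennreal_ofReal
  have hm₂ : Measurable fun x : State d => ENNReal.ofReal (‖act B x‖ ^ 2) := by fun_prop
  have hnoise : ∫⁻ η, ENNReal.ofReal (‖act B (η t)‖ ^ 2) ∂μ =
      ENNReal.ofReal (σ ^ 2 * frobSq B) := by
    rw [← lintegral_norm_act_sq σ B]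
    exact (measurePreserving_eval (fun _ : Fin (n + 1) =>
      multivariateGaussian 0 (σ ^ 2 • (1 : Matrix (Fin d) (Fin d) ℝ))) t).lintegral_comp hm₂
  have hrefl := (measurePreserving_reflect σ t).lintegral_comp hm
  have hpar : ∀ η : Fin (n + 1) → State d,
      ENNReal.ofReal (‖act B (path A (reflect t η) (t + 1))‖ ^ 2) +
        ENNReal.ofReal (‖act B (path A η (t + 1))‖ ^ 2) =
      2 * (ENNReal.ofReal (‖act (B * A) (path A η t)‖ ^ 2) +
        ENNReal.ofReal (‖act B (η t)‖ ^ 2)) := by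
    intro η
    have h1 : path A (reflect t η) t = path A η t := by
      refine path_congr A t fun s hs => ?_
      have : s ≠ t := fun h => by simp [h] at hs
      simp [reflect, this]
    have h2 : reflect t η t = -η t := by simp [reflect]
    rw [path_succ, path_succ, h1, h2, hBA, ← ENNReal.ofReal_add (by positivity) (by positivity),
      ← ENNReal.ofReal_add (by positivity) (by positivity),
      two_mul, ← ENNReal.ofReal_add (by positivity) (by positivity)]
    congr 1
    have := parallelogram_law_with_norm ℝ (act B (act A (path A η t))) (act B (η t))
    rw [map_add, map_add, map_neg, ContinuousLinearMap.comp_apply, ← sub_eq_add_neg]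
    linarith
  have h2 : 2 * ∫⁻ η, ENNReal.ofReal (‖act B (path A η (t + 1))‖ ^ 2) ∂μ =
      2 * (∫⁻ η, ENNReal.ofReal (‖act (B * A) (path A η t)‖ ^ 2) ∂μ +
        ENNReal.ofReal (σ ^ 2 * frobSq B)) := by
    rw [← hnoise, ← lintegral_add_left hm₁, ← lintegral_const_mul' 2 (fun η => _ + _) (by simp),
      ← lintegral_congr hpar, lintegral_add_right _ hm, hrefl, two_mul]
  exact (ENNReal.mul_right_inj (by simp) (by simp)).1 h2

lemma lintegral_norm_act_path_le {d n : ℕ} (σ : ℝ) {A : Matrix (Fin d) (Fin d) ℝ} {q : ℝ}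
    (hA : frobSq A ≤ q) (B : Matrix (Fin d) (Fin d) ℝ) (t : ℕ) (ht : t ≤ n + 1) :
    ∫⁻ η, ENNReal.ofReal (‖act B (path A η t)‖ ^ 2) ∂(innovationLaw d n σ) ≤
      ENNReal.ofReal (σ ^ 2 * frobSq B * ∑ s ∈ Finset.range t, q ^ s) := by
  have hq : 0 ≤ q := (frobSq_nonneg A).trans hA
  -- One step back in time replaces `B` by `B * A`, so the induction must run over all `B`.
  induction t generalizing B with
  | zero => simp [path]
  | succ t ih =>
    have hB := frobSq_nonneg B
    have hS : 0 ≤ ∑ s ∈ Finset.range t, q ^ s := Finset.sum_nonneg fun s _ => pow_nonneg hq s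
    rw [lintegral_norm_act_path_succ σ A B ⟨t, ht⟩]
    refine (add_le_add_left (ih (B * A) (by omega)) _).trans ?_
    rw [← ENNReal.ofReal_add (by have := frobSq_nonneg (B * A); positivity) (by positivity)]
    refine ENNReal.ofReal_le_ofReal ?_
    have h1 : frobSq (B * A) ≤ frobSq B * q :=
      (frobSq_mul_le B A).trans (mul_le_mul_of_nonneg_left hA hB)
    calc σ ^ 2 * frobSq (B * A) * ∑ s ∈ Finset.range t, q ^ s + σ ^ 2 * frobSq B
        ≤ σ ^ 2 * (frobSq B * q) * ∑ s ∈ Finset.range t, q ^ s + σ ^ 2 * frobSq B := by gcongr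
      _ = σ ^ 2 * frobSq B * ∑ s ∈ Finset.range (t + 1), q ^ s := by
        rw [geom_sum_succ]
        ring

/-- Chebyshev's bound for the energy of the signal `B x_{t-1}`. -/
lemma sampleLaw_energy_ge_le {d n : ℕ} {σ : ℝ} (hσ : 0 < σ) {A : Matrix (Fin d) (Fin d) ℝ} {q : ℝ}
    (hA : frobSq A ≤ q) (B : Matrix (Fin d) (Fin d) ℝ) {v : ℝ} (hv : 0 < v) :
    sampleLaw n σ A {x | v ≤ energy n σ B x} ≤
      ENNReal.ofReal (frobSq B * (∑ t ∈ Finset.range (n + 1), ∑ s ∈ Finset.range t, q ^ s) / v) := by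
  have hq : 0 ≤ q := (frobSq_nonneg A).trans hA
  have hB := frobSq_nonneg B
  have hS : ∀ t, 0 ≤ ∑ s ∈ Finset.range t, q ^ s := fun t =>
    Finset.sum_nonneg fun s _ => pow_nonneg hq s
  have hE : ∫⁻ x, ENNReal.ofReal (energy n σ B x) ∂(sampleLaw n σ A) ≤
      ENNReal.ofReal (frobSq B * ∑ t ∈ Finset.range (n + 1), ∑ s ∈ Finset.range t, q ^ s) := by
    unfold sampleLaw
    rw [lintegral_map (measurable_energy n σ B).ennreal_ofReal (measurable_sample A)]
    unfold energy
    simp_rw [lag_path, div_eq_inv_mul, ENNReal.ofReal_mul (inv_nonneg.2 (sq_nonneg σ)),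
      ENNReal.ofReal_sum_of_nonneg fun t _ => sq_nonneg _]
    rw [lintegral_const_mul' _ _ (by simp), lintegral_finsetSum _ fun t _ => ?_]
    · calc _ ≤ ENNReal.ofReal (σ ^ 2)⁻¹ * ∑ t : Fin (n + 1),
            ENNReal.ofReal (σ ^ 2 * frobSq B * ∑ s ∈ Finset.range t, q ^ s) :=
          mul_le_mul_right (Finset.sum_le_sum fun (t : Fin (n + 1)) _ =>
            lintegral_norm_act_path_le σ hA B (t : ℕ) t.2.le) _
        _ = _ := by
          rw [← ENNReal.ofReal_sum_of_nonneg fun (t : Fin (n + 1)) _ =>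
            mul_nonneg (by positivity) (hS t),
            ← ENNReal.ofReal_mul (by positivity), ← Finset.mul_sum,
            Finset.sum_range (fun t => ∑ s ∈ Finset.range t, q ^ s)]
          congr 1
          field_simp
    · exact (((act B).continuous.measurable.comp (measurable_path A t)).norm.pow_const
        2).ennreal_ofReal
  have h := meas_ge_le_lintegral_div (μ := sampleLaw n σ A)
    (measurable_energy n σ B).ennreal_ofReal.aemeasurable (ε := ENNReal.ofReal v)
    (by simpa using hv) (by simp)
  refine le_trans (measure_mono fun x hx => ENNReal.ofReal_le_ofReal hx) (h.trans ?_)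
  rw [ENNReal.ofReal_div_of_pos hv]
  exact ENNReal.div_le_div_right hE _

/-! ### Averaging over a ball -/

/-- For every estimator some point of a ball of twice the radius is hit with probability at most
`2 ^ (-dim)`. -/
lemma exists_measure_norm_sub_lt_le {X E : Type*} [MeasurableSpace X] [NormedAddCommGroup E]
    [NormedSpace ℝ E] [FiniteDimensional ℝ E] [MeasurableSpace E] [BorelSpace E]
    (Q : Measure X) [IsProbabilityMeasure Q] {w : X → E} (hw : Measurable w) {ε : ℝ} (hε : 0 < ε) :
    ∃ v : E, ‖v‖ < 2 * ε ∧
      Q {x | ‖w x - v‖ < ε} ≤ ENNReal.ofReal ((1 / 2) ^ Module.finrank ℝ E) := by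
  by_contra! hcon
  let μ : Measure E := Measure.addHaar
  set k := Module.finrank ℝ E
  have h2 : μ (Metric.ball 0 (2 * ε)) = ENNReal.ofReal (2 ^ k) * μ (Metric.ball 0 ε) :=
    Measure.addHaar_ball_mul_of_pos μ 0 two_pos ε
  have hpos : μ (Metric.ball 0 (2 * ε)) ≠ 0 :=
    (Metric.measure_ball_pos μ 0 (by positivity)).ne'
  have hfin : μ (Metric.ball 0 (2 * ε)) ≠ ∞ := measure_ball_lt_top.ne
  have hmeas : MeasurableSet {p : E × X | ‖w p.2 - p.1‖ < ε} :=
    measurableSet_lt (((hw.comp measurable_snd).sub measurable_fst).norm) measurable_const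
  -- If every centre failed, integrating over the large ball would give more than `2^(-k)` times its
  -- volume, that is, more than the volume of the small ball; exchanging the integrals shows the
  -- opposite.
  have hlt : ∫⁻ _ in Metric.ball (0 : E) (2 * ε), ENNReal.ofReal ((1 / 2) ^ k) ∂μ <
      ∫⁻ v in Metric.ball (0 : E) (2 * ε), Q {x | ‖w x - v‖ < ε} ∂μ := by
    refine setLIntegral_strict_mono measurableSet_ball hpos
      (measurable_measure_prodMk_left hmeas) ?_ (ae_of_all _ fun v hv => hcon v (by simpa using hv))
    simpa using ENNReal.mul_ne_top (by simp) hfin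
  refine absurd hlt (not_lt.2 ?_)
  calc ∫⁻ v in Metric.ball (0 : E) (2 * ε), Q {x | ‖w x - v‖ < ε} ∂μ
      = ((μ.restrict (Metric.ball (0 : E) (2 * ε))).prod Q) {p : E × X | ‖w p.2 - p.1‖ < ε} :=
        (Measure.prod_apply hmeas).symm
    _ = ∫⁻ x, μ.restrict (Metric.ball (0 : E) (2 * ε)) {v | ‖w x - v‖ < ε} ∂Q :=
        Measure.prod_apply_symm hmeas
    _ ≤ ∫⁻ _, μ (Metric.ball 0 ε) ∂Q := by
        refine lintegral_mono fun x => (Measure.restrict_apply_le _ _).trans ?_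
        have : {v | ‖w x - v‖ < ε} = Metric.ball (w x) ε := by
          ext v
          rw [Metric.mem_ball', dist_eq_norm]
          rfl
        rw [this, Measure.addHaar_ball_center]
    _ = ∫⁻ _ in Metric.ball (0 : E) (2 * ε), ENNReal.ofReal ((1 / 2) ^ k) ∂μ := by
        rw [setLIntegral_const, h2, ← mul_assoc, ← ENNReal.ofReal_mul (by positivity), ← mul_pow]
        simp

/-! ### The two-point comparison in the restricted space -/

lemma coef_eq {d m : ℕ} (R : Matrix (Fin d × Fin d) (Fin m) ℝ) (γ : Coef d)
    (θ : EuclideanSpace ℝ (Fin m)) : coef R γ θ = Matrix.toLpLin 2 2 R θ + γ := rfl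

lemma finrank_range_toLpLin {d m : ℕ} (R : Matrix (Fin d × Fin d) (Fin m) ℝ) :
    Module.finrank ℝ (LinearMap.range (Matrix.toLpLin 2 2 R)) = R.rank := by
  rw [Matrix.toLpLin_eq_toLin]
  exact (R.rank_eq_finrank_range_toLin _ _).symm

lemma transition_add {d : ℕ} (β β' : Coef d) :
    transition (β + β') = transition β + transition β' := rfl

lemma exp_mul_half_pow_le {m : ℕ} (hm : 1 ≤ m) :
    Real.exp (m / 10) * (1 / 2) ^ m ≤ 3 / 5 := by
  have h : Real.exp (1 / 10) ≤ 6 / 5 := by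
    refine le_of_pow_le_pow_left₀ (n := 10) (by norm_num) (by norm_num) ?_
    rw [← Real.exp_nat_mul]
    have := Real.exp_one_lt_d9
    norm_num at this ⊢
    linarith
  have h1 : Real.exp (m / 10) = Real.exp (1 / 10) ^ m := by
    rw [← Real.exp_nat_mul]
    ring_nf
  rw [h1, ← mul_pow]
  have h2 : Real.exp (1 / 10) * (1 / 2) ≤ 3 / 5 := by linarith
  calc _ ≤ (3 / 5 : ℝ) ^ m := pow_le_pow_left₀ (by positivity) h2 m
    _ ≤ 3 / 5 := pow_le_of_le_one (by norm_num) (by norm_num) (by omega)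

lemma exp_neg_three_mul_le {m : ℕ} (hm : 1 ≤ m) : Real.exp (-(3 * m)) ≤ 1 / 16 := by
  have h1 : (1 : ℝ) ≤ m := by exact_mod_cast hm
  have h2 : Real.exp (-(3 * m)) ≤ Real.exp (-3) := Real.exp_le_exp.2 (by linarith)
  have h3 : (16 : ℝ) ≤ Real.exp 3 := by
    have h4 : Real.exp 3 = Real.exp 1 ^ 3 := by
      rw [← Real.exp_nat_mul]
      norm_num
    rw [h4]
    have h5 : (2.7 : ℝ) ≤ Real.exp 1 := by linarith [Real.exp_one_gt_d9]
    exact le_trans (by norm_num) (pow_le_pow_left₀ (by norm_num) h5 3)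
  rw [Real.exp_neg 3] at h2
  exact h2.trans (by rw [one_div]; exact inv_anti₀ (by norm_num) h3)

/-- The sum of the spectral bounds `∑_{s < t} ρ^{2s}` on the state covariances. -/
noncomputable def covSum (n : ℕ) (ρ : ℝ) : ℝ :=
  ∑ t ∈ Finset.range (n + 1), ∑ s ∈ Finset.range t, (ρ ^ 2) ^ s

lemma covSum_nonneg (n : ℕ) (ρ : ℝ) : 0 ≤ covSum n ρ :=
  Finset.sum_nonneg fun _ _ => Finset.sum_nonneg fun _ _ => by positivity

/-- The term `t = 0` is empty, because `X_0 = 0`; this leaves `n` terms rather than `n + 1`. -/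
lemma covSum_le {n : ℕ} {ρ K : ℝ} (h : ∀ t ≤ n, ∑ s ∈ Finset.range t, (ρ ^ 2) ^ s ≤ K) :
    covSum n ρ ≤ n * K := by
  rw [covSum, Finset.sum_range_succ', Finset.sum_range_zero, add_zero]
  refine (Finset.sum_le_card_nsmul _ _ K fun t ht => h _ ?_).trans_eq (by simp)
  exact Finset.mem_range.1 ht

/-- The probability of hitting a ball of radius `ε` under a nearby transition matrix. -/
lemma sampleLaw_add_transition_le {n d m : ℕ} {σ ρ ε : ℝ} (hσ : 0 < σ) (hm : 1 ≤ m)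
    (hε : ε ^ 2 * covSum n ρ ≤ m / 40000) {β₀ v : Coef d} (hβ : ‖β₀ + v‖ ≤ ρ)
    (hv : ‖v‖ ≤ 2 * ε) {s : Set (Fin (n + 1) → State d)} (hs : MeasurableSet s)
    (h : sampleLaw n σ (transition β₀) s ≤ ENNReal.ofReal ((1 / 2) ^ m)) :
    sampleLaw n σ (transition (β₀ + v)) s ≤ ENNReal.ofReal (3 / 4) := by
  have hm0 : (0 : ℝ) < m := by exact_mod_cast hm
  have hA : frobSq (transition (β₀ + v)) ≤ ρ ^ 2 := by
    rw [frobSq_transition]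
    exact pow_le_pow_left₀ (norm_nonneg _) hβ 2
  have h1 := sampleLaw_energy_ge_le (n := n) hσ hA (transition v) (v := m / 820) (by positivity)
  -- The energy threshold `m / 820` matches `u + u² = 1640` at `u = 40`: the Chernoff exponent is
  -- `4m - m = 3m`.
  have h2 := sampleLaw_add_le (n := n) hσ (transition β₀) (transition v) (u := 40) (m / 10)
    (m / 820) (by norm_num) hs
  rw [← transition_add] at h2
  -- Here `‖v‖² ≤ 4ε²`, and `4 * 820 / 40000 = 0.082`.
  have h3 : frobSq (transition v) * covSum n ρ / (m / 820) ≤ 82 / 1000 := by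
    rw [div_le_iff₀ (by positivity), frobSq_transition]
    have := mul_le_mul_of_nonneg_right (pow_le_pow_left₀ (norm_nonneg _) hv 2) (covSum_nonneg n ρ)
    linarith
  have h4 : -(40 * ((m : ℝ) / 10) - (40 + 40 ^ 2) * (m / 820) / 2) = -(3 * m) := by ring
  rw [h4] at h2
  calc sampleLaw n σ (transition (β₀ + v)) s
      ≤ ENNReal.ofReal (82 / 1000) + ENNReal.ofReal (Real.exp (m / 10)) *
        ENNReal.ofReal ((1 / 2) ^ m) + ENNReal.ofReal (1 / 16) := by
        refine h2.trans (add_le_add (add_le_add (h1.trans (ENNReal.ofReal_le_ofReal h3))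
          (mul_le_mul_right h _)) (ENNReal.ofReal_le_ofReal (exp_neg_three_mul_le hm)))
    _ ≤ ENNReal.ofReal (82 / 1000) + ENNReal.ofReal (3 / 5) + ENNReal.ofReal (1 / 16) := by
        rw [← ENNReal.ofReal_mul (Real.exp_nonneg _)]
        gcongr
        exact exp_mul_half_pow_le hm
    _ ≤ ENNReal.ofReal (3 / 4) := by
        rw [← ENNReal.ofReal_add (by norm_num) (by norm_num),
          ← ENNReal.ofReal_add (by norm_num) (by norm_num)]
        exact ENNReal.ofReal_le_ofReal (by norm_num)

lemma exists_norm_coef_lt {d m : ℕ} {R : Matrix (Fin d × Fin d) (Fin m) ℝ} {γ : Coef d} {r : ℝ}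
    (h : offset R γ < r) : ∃ θ, ‖coef R γ θ‖ < r := by
  obtain ⟨_, ⟨θ, rfl⟩, hθ⟩ := (Metric.infDist_lt_iff (Set.range_nonempty _)).1 h
  exact ⟨θ, by simpa using hθ⟩

lemma mem_Theta_of_norm_le {d m : ℕ} {R : Matrix (Fin d × Fin d) (Fin m) ℝ} {γ : Coef d} {ρ : ℝ}
    {θ : EuclideanSpace ℝ (Fin m)} (hρ : 0 ≤ ρ) (h : ‖coef R γ θ‖ ≤ ρ) : θ ∈ Theta R γ ρ := by
  refine specRad_le hρ ?_
  rw [frobSq_transition]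
  exact pow_le_pow_left₀ (norm_nonneg _) h 2

lemma exists_mem_Theta_sampleLaw_le {n d m : ℕ} {σ ρ ε : ℝ}
    {R : Matrix (Fin d × Fin d) (Fin m) ℝ} {γ : Coef d} (hσ : 0 < σ) (hR : R.rank = m)
    (hρ : 0 < ρ) (hε0 : 0 < ε) (hε : ε ≤ (ρ - offset R γ) / 4)
    (hm : 1 ≤ m) (hG : ε ^ 2 * covSum n ρ ≤ m / 40000) (b : Estimator n R γ) :
    ∃ θ ∈ Theta R γ ρ, sampleLaw n σ (transition (coef R γ θ)) {x | ‖b.1 x - coef R γ θ‖ < ε} ≤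
      ENNReal.ofReal (3 / 4) := by
  -- The midpoint leaves room `(ρ - D) / 2 ≥ 2ε` for the perturbation.
  obtain ⟨θ₀, hθ₀⟩ := exists_norm_coef_lt (R := R) (γ := γ) (r := (offset R γ + ρ) / 2)
    (by linarith)
  set T := Matrix.toLpLin 2 2 R
  have hb : ∀ x, b.1 x - coef R γ θ₀ ∈ LinearMap.range T := by
    intro x
    obtain ⟨θ, hθ⟩ := b.2.2 x
    refine ⟨θ - θ₀, ?_⟩
    rw [← hθ, coef_eq, coef_eq, map_sub]
    abel
  have hw : Measurable fun x => (⟨b.1 x - coef R γ θ₀, hb x⟩ : LinearMap.range T) :=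
    (b.2.1.sub_const _).subtype_mk
  obtain ⟨⟨_, θ₁, rfl⟩, hv, hQ⟩ := exists_measure_norm_sub_lt_le
    (sampleLaw n σ (transition (coef R γ θ₀))) hw hε0
  rw [finrank_range_toLpLin, hR] at hQ
  have hθ : coef R γ (θ₀ + θ₁) = coef R γ θ₀ + T θ₁ := by
    rw [coef_eq, coef_eq, map_add]
    abel
  have hv' : ‖T θ₁‖ < 2 * ε := hv
  have hnorm : ‖coef R γ θ₀ + T θ₁‖ ≤ ρ := (norm_add_le _ _).trans (by linarith)
  refine ⟨θ₀ + θ₁, mem_Theta_of_norm_le hρ.le (hθ ▸ hnorm), ?_⟩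
  rw [hθ]
  refine sampleLaw_add_transition_le hσ hm hG hnorm hv'.le
    (measurableSet_lt (b.2.1.sub_const _).norm measurable_const) (le_trans (le_of_eq ?_) hQ)
  congr 1
  ext x
  simp only [← sub_sub]
  rfl

lemma le_minimaxProb {n d m : ℕ} {σ ρ ε : ℝ}
    {R : Matrix (Fin d × Fin d) (Fin m) ℝ} {γ : Coef d} (hσ : 0 < σ) (hR : R.rank = m)
    (hρ : 0 < ρ) (hoff : offset R γ < ρ) (hε : ε ≤ (ρ - offset R γ) / 4)
    (hG : 0 < ε → 1 ≤ m ∧ ε ^ 2 * covSum n ρ ≤ m / 40000) :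
    ENNReal.ofReal (1 / 4) ≤ minimaxProb n σ R γ ρ ε := by
  refine le_iInf fun b => ?_
  -- For `ε ≤ 0` the event is the whole space; this covers `m = 0`, where the rate vanishes.
  rcases le_or_gt ε 0 with h0 | h0
  · obtain ⟨θ, hθ⟩ := exists_norm_coef_lt hoff
    refine le_trans ?_ (le_iSup₂ (f := fun θ _ => sampleLaw n σ (transition (coef R γ θ))
      {x | ε ≤ ‖b.1 x - coef R γ θ‖}) θ (mem_Theta_of_norm_le hρ.le hθ.le))
    have : {x | ε ≤ ‖b.1 x - coef R γ θ‖} = Set.univ :=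
      Set.eq_univ_of_forall fun x => h0.trans (norm_nonneg _)
    rw [this, measure_univ]
    exact ENNReal.ofReal_le_one.2 (by norm_num)
  · obtain ⟨θ, hθ, h⟩ := exists_mem_Theta_sampleLaw_le hσ hR hρ h0 hε (hG h0).1 (hG h0).2 b
    refine le_trans ?_ (le_iSup₂ (f := fun θ _ => sampleLaw n σ (transition (coef R γ θ))
      {x | ε ≤ ‖b.1 x - coef R γ θ‖}) θ hθ)
    have hs : MeasurableSet {x | ‖b.1 x - coef R γ θ‖ < ε} :=
      measurableSet_lt (b.2.1.sub_const _).norm measurable_const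
    have : {x | ε ≤ ‖b.1 x - coef R γ θ‖} = {x | ‖b.1 x - coef R γ θ‖ < ε}ᶜ := by
      ext x
      simp
    rw [this, prob_compl_eq_one_sub hs]
    refine le_trans (le_of_eq ?_) (tsub_le_tsub_left h 1)
    rw [← ENNReal.ofReal_one, ← ENNReal.ofReal_sub _ (by norm_num)]
    norm_num

/-- The minimax bound for a rate `r` matched to the total state covariance. -/
lemma le_minimaxProb_min {n d m : ℕ} {σ δ ρ r : ℝ}
    {R : Matrix (Fin d × Fin d) (Fin m) ℝ} {γ : Coef d} (hσ : 0 < σ) (hδ : δ < 1 / 4)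
    (hR : R.rank = m) (hρ : 0 < ρ) (hoff : offset R γ < ρ)
    (hm : m = 0 → r = 0) (hr : r ^ 2 * covSum n ρ ≤ m / 40000) :
    ENNReal.ofReal δ ≤ minimaxProb n σ R γ ρ (min r ((ρ - offset R γ) / 4)) := by
  refine (ENNReal.ofReal_le_ofReal hδ.le).trans
    (le_minimaxProb hσ hR hρ hoff (min_le_right _ _) fun h0 => ⟨?_, ?_⟩)
  · rcases Nat.eq_zero_or_pos m with h | h
    · exact absurd (hm h) (h0.trans_le (min_le_left _ _)).ne'
    · exact h
  · exact (mul_le_mul_of_nonneg_right (pow_le_pow_left₀ h0.le (min_le_left _ _) 2)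
      (covSum_nonneg n ρ)).trans hr

/-! ### Geometric sums and the three rates -/

lemma geom_sum_le_of_lt_one {q : ℝ} (hq0 : 0 ≤ q) (hq : q < 1) (t : ℕ) :
    ∑ s ∈ Finset.range t, q ^ s ≤ 1 / (1 - q) := by
  rw [le_div_iff₀ (by linarith), geom_sum_mul_neg]
  linarith [pow_nonneg hq0 t]

lemma geom_sum_le_of_one_lt {q : ℝ} (hq : 1 < q) {t n : ℕ} (ht : t ≤ n) :
    ∑ s ∈ Finset.range t, q ^ s ≤ q ^ n / (q - 1) := by
  rw [le_div_iff₀ (by linarith), geom_sum_mul]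
  linarith [pow_le_pow_right₀ hq.le ht]

lemma geom_sum_le_of_le_one_add {ρ c : ℝ} {n : ℕ} (hn : 1 ≤ n) (hρ : 0 ≤ ρ) (hc : 0 ≤ c)
    (h : ρ ≤ 1 + c / n) {t : ℕ} (ht : t ≤ n) :
    ∑ s ∈ Finset.range t, (ρ ^ 2) ^ s ≤ n * Real.exp (2 * c) := by
  have hn0 : (0 : ℝ) < n := by exact_mod_cast hn
  have hρ' : ρ ≤ Real.exp (c / n) := by linarith [Real.add_one_le_exp (c / n)]
  have hterm : ∀ s ∈ Finset.range t, (ρ ^ 2) ^ s ≤ Real.exp (2 * c) := by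
    intro s hs
    have hs' : (s : ℝ) ≤ n := by
      exact_mod_cast ((Finset.mem_range.1 hs).trans_le ht).le
    calc (ρ ^ 2) ^ s ≤ (Real.exp (c / n) ^ 2) ^ s := by gcongr
      _ = Real.exp (2 * c * (s / n)) := by
        rw [← Real.exp_nat_mul, ← Real.exp_nat_mul]
        congr 1
        push_cast
        ring
      _ ≤ Real.exp (2 * c) := Real.exp_le_exp.2
        (mul_le_of_le_one_right (by positivity) ((div_le_one hn0).2 hs'))
  refine (Finset.sum_le_card_nsmul _ _ _ hterm).trans ?_
  rw [Finset.card_range, nsmul_eq_mul]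
  gcongr

end RestrictedVAR

open RestrictedVAR in
theorem corollary1 :
    ∃ C : ℝ, 0 < C ∧ ∀ c : ℝ, 0 < c → ∃ Cc : ℝ, 0 < Cc ∧
      ∀ (n d m : ℕ) (σ δ ρ : ℝ) (R : Matrix (Fin d × Fin d) (Fin m) ℝ) (γ : Coef d),
        1 ≤ n → 0 < σ → 0 < δ → δ < 1 / 4 → R.rank = m → 0 < ρ → offset R γ < ρ →
        (ρ < Real.sqrt (1 - 1 / (n : ℝ)) →
          ENNReal.ofReal δ ≤ minimaxProb n σ R γ ρ
            (min (C * Real.sqrt ((1 - ρ ^ 2) * m / n)) ((ρ - offset R γ) / 4))) ∧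
        (Real.sqrt (1 - 1 / (n : ℝ)) ≤ ρ → ρ ≤ 1 + c / n →
          ENNReal.ofReal δ ≤ minimaxProb n σ R γ ρ
            (min (Cc * (Real.sqrt m / n)) ((ρ - offset R γ) / 4))) ∧
        (1 + c / n < ρ →
          ENNReal.ofReal δ ≤ minimaxProb n σ R γ ρ
            (min (C * ((ρ ^ n)⁻¹ * Real.sqrt ((ρ ^ 2 - 1) * m / n)))
              ((ρ - offset R γ) / 4))) := by
  -- `(1 / 200)² = 1 / 40000`, and `exp (-c)` squared cancels the factor `exp (2 * c)` in the bound
  -- on `covSum` near one.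
  refine ⟨1 / 200, by norm_num, fun c hc => ⟨Real.exp (-c) / 200, by positivity, ?_⟩⟩
  intro n d m σ δ ρ R γ hn hσ _ hδ hR hρ hoff
  have hn0 : (0 : ℝ) < n := by exact_mod_cast hn
  have hm0 : (0 : ℝ) ≤ m := m.cast_nonneg
  refine ⟨fun h => ?_, fun _ h => ?_, fun h => ?_⟩
  · have hq : ρ ^ 2 < 1 := by
      have h1 := (Real.lt_sqrt hρ.le).1 h
      have h2 : 0 < 1 / (n : ℝ) := by positivity
      linarith
    have hq' : 0 < 1 - ρ ^ 2 := by linarith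
    refine le_minimaxProb_min hσ hδ hR hρ hoff (fun h0 => by simp [h0]) ?_
    calc _ ≤ (1 / 200 * √((1 - ρ ^ 2) * m / n)) ^ 2 * (n * (1 / (1 - ρ ^ 2))) :=
          mul_le_mul_of_nonneg_left (covSum_le fun t _ =>
            geom_sum_le_of_lt_one (sq_nonneg ρ) hq t) (sq_nonneg _)
      _ = m / 40000 := by
          rw [mul_pow, Real.sq_sqrt (by positivity)]
          field_simp
          norm_num
          ring
  · refine le_minimaxProb_min hσ hδ hR hρ hoff (fun h0 => by simp [h0]) ?_
    calc _ ≤ (Real.exp (-c) / 200 * (√m / n)) ^ 2 * (n * (n * Real.exp (2 * c))) :=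
          mul_le_mul_of_nonneg_left (covSum_le fun t ht =>
            geom_sum_le_of_le_one_add hn hρ.le hc.le h ht) (sq_nonneg _)
      _ = (Real.exp (-c) * Real.exp (-c) * Real.exp (2 * c)) * (m / 40000) := by
          rw [mul_pow, div_pow (√m), Real.sq_sqrt hm0]
          field_simp
          norm_num
          ring
      _ = m / 40000 := by
          rw [← Real.exp_add, ← Real.exp_add, show -c + -c + 2 * c = 0 by ring, Real.exp_zero,
            one_mul]
  · have h1 : 1 < ρ := by
      have : 0 < c / n := by positivity
      linarith
    have hq : 1 < ρ ^ 2 := one_lt_pow₀ h1 two_ne_zero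
    have hq' : 0 < ρ ^ 2 - 1 := by linarith
    refine le_minimaxProb_min hσ hδ hR hρ hoff (fun h0 => by simp [h0]) ?_
    calc _ ≤ (1 / 200 * ((ρ ^ n)⁻¹ * √((ρ ^ 2 - 1) * m / n))) ^ 2 *
          (n * ((ρ ^ 2) ^ n / (ρ ^ 2 - 1))) :=
          mul_le_mul_of_nonneg_left (covSum_le fun t ht => geom_sum_le_of_one_lt hq ht)
            (sq_nonneg _)
      _ = m / 40000 := by
          rw [mul_pow, mul_pow, Real.sq_sqrt (by positivity), ← pow_mul, mul_comm 2 n, pow_mul]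
          field_simp
          norm_num
          ring
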